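/- Let $\Gamma$ be a finite Abelian group, written additively. A subset $S\subseteq\Gamma$ is called a \emph{covering set} of $\Gamma$ if every element of $\Gamma$ equals $a-b$ for some $a,b\in S$. An \emph{$(n,s,\lambda,t)$ almost difference set} is an $s$-element subset $S$ of a group of order $n$ such that, in the multiset of differences $\{a-b : (a,b)\in S\times S\}$, exactly $t$ of the nonidentity group elements occur exactly $\lambda$ times and all the other nonidentity elements occur exactly $\lambda+1$ times. The maximum order $n$ of a finite Abelian group having a covering set $S$ with $|S|=7$ is $n=39$ (in particular, no Abelian group of order $40$, $41$, $42$ or $43$ has a covering set with $7$ elements). Moreover, the set $S=\{0,1,2,4,13,18,33\}\subseteq\mathbb{Z}_{39}$ is a covering set of $\mathbb{Z}_{39}$ and a $(39,7,1,34)$ almost difference set. -/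

import Mathlib

universe u

/-- The multiset of all differences `a - b` with `a, b ∈ S` (the entries of the difference matrix
of `S`, diagonal included). -/
def differenceMultiset {Γ : Type*} [AddGroup Γ] (S : Finset Γ) : Multiset Γ :=
  (S ×ˢ S).val.map (fun p => p.1 - p.2)

/-- `S` is a covering (difference) set of `Γ`: every element of `Γ` is a difference of two elements
of `S`. -/
def IsCoveringSet {Γ : Type*} [AddGroup Γ] (S : Finset Γ) : Prop :=
  ∀ g : Γ, g ∈ differenceMultiset S

/-- `S` is an `(n, s, l, t)`-almost difference set: an `s`-subset of a group of order `n` such that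
exactly `t` of the nonidentity elements occur exactly `l` times in the multiset of differences, and
all the other nonidentity elements occur exactly `l + 1` times. -/
def IsAlmostDifferenceSet {Γ : Type*} [AddGroup Γ] [DecidableEq Γ] (S : Finset Γ)
    (n s l t : ℕ) : Prop :=
  Finite Γ ∧ Nat.card Γ = n ∧ S.card = s ∧
    {g : Γ | g ≠ 0 ∧ (differenceMultiset S).count g = l}.ncard = t ∧
    ∀ g : Γ, g ≠ 0 → (differenceMultiset S).count g ≠ l → (differenceMultiset S).count g = l + 1

/-! A 7-set has 42 ordered pairs of distinct elements, so a covering set in order `n` forces `n ≤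
43` and leaves `43 - n` repetitions among its nonzero differences. Orders 40 to 43 are excluded by
spending this slack.

If `Γ` has a summand of order 2 (all of order 42, and the noncyclic ones of order 40), counting
differences by their class modulo the index-2 kernel of `χ` gives a contradiction:
`sub_ne_univ_of_hom_zmod_two`.

The cyclic groups of order 40, 41, 43 remain. In orders 40 and 41 a coincidence `a - b = c - d` on
four distinct elements costs four repetitions, which is too many. So coincidences come from
three-term progressions, and counting forces one to exist (`exists_arithmetic_progression`). An
affine map normalizes it, and a branch-and-bound search with the remaining slack as budget, proved
sound in `noExtension_sound`, finds no completion. In order 43 the search starts from a pair with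
difference 1. -/

open scoped Pointwise

/-! ### Branch-and-bound search with a budget of repeated differences -/

/-- Continue after paying one unit of the budget `b` if bit `d` of `D` is already set;
answer `true` when the budget is exhausted. -/
def recordBit (D b d : ℕ) (k : ℕ → ℕ → Bool) : Bool :=
  match Nat.beq (Nat.land 1 (Nat.shiftRight D d)) 0 with
  | true => k (Nat.lor D (Nat.shiftLeft 1 d)) b
  | false => match b with
    | 0 => true
    | c + 1 => k D c

/-- Record all differences modulo `n` of `x` with the members of a list, in both directions. -/
noncomputable def recordDifferences (n x : ℕ) (A : List ℕ) : ℕ → ℕ → (ℕ → ℕ → Bool) → Bool :=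
  List.rec (fun D b k => k D b)
    (fun a _ ih D b k => recordBit D b (Nat.mod (Nat.sub (Nat.add a n) x) n) fun D b =>
      recordBit D b (Nat.mod (Nat.sub (Nat.add x n) a) n) fun D b => ih D b k) A

/-- `noExtension n x r A D b` tells that `A`, with differences the bits of `D`, cannot be extended
by `r` numbers below `x` with at most `b` repeated differences. -/
noncomputable def noExtension (n x : ℕ) : ℕ → List ℕ → ℕ → ℕ → Bool :=
  -- With no candidates left, `r = 0` means a completed set, hence failure; a positive `r` means a
  -- dead branch.
  Nat.rec (fun r _ _ _ => match r with | 0 => false | _ + 1 => true)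
    (fun y ih r A D b => match r with
      | 0 => false
      | s + 1 => match ih (s + 1) A D b with
        | true => recordDifferences n y A D b fun D b => ih s (y :: A) D b
        | false => false) x

/-- The bits of `D` are the residues in `F`. -/
def Encodes {n : ℕ} (D : ℕ) (F : Finset (ZMod n)) : Prop :=
  ∀ d < n, D.testBit d = true ↔ (d : ZMod n) ∈ F

theorem Encodes.insert {n : ℕ} {D d : ℕ} {F : Finset (ZMod n)} (h : Encodes D F) (hd : d < n) :
    Encodes (Nat.lor D (Nat.shiftLeft 1 d)) (insert (d : ZMod n) F) := by
  intro e he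
  have : (Nat.lor D (Nat.shiftLeft 1 d)) = D ||| (1 <<< d) := rfl
  rw [this, Nat.testBit_or, Nat.one_shiftLeft, Nat.testBit_two_pow, Finset.mem_insert,
    Bool.or_eq_true, h e he, decide_eq_true_iff]
  have : (e : ZMod n) = d ↔ d = e := by
    rw [ZMod.natCast_eq_natCast_iff', Nat.mod_eq_of_lt he, Nat.mod_eq_of_lt hd, eq_comm]
  rw [this, or_comm]

/-- The budget spent, `b - b'`, is exactly the deficit of the new cardinality from `F.card + 1`; the
strict inequality is the overdrawn case. -/
theorem recordBit_sound {n D b d : ℕ} {F : Finset (ZMod n)} {k : ℕ → ℕ → Bool}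
    (h : recordBit D b d k = true) (hF : Encodes D F) (hd : d < n) :
    (∃ D' b', k D' b' = true ∧ Encodes D' (insert (d : ZMod n) F) ∧
      (insert (d : ZMod n) F).card + b = F.card + 1 + b') ∨
    (insert (d : ZMod n) F).card + b < F.card + 1 := by
  have key : Nat.beq (Nat.land 1 (Nat.shiftRight D d)) 0 = !D.testBit d := by
    have h1 : (Nat.land 1 (Nat.shiftRight D d)) = 1 &&& (D >>> d) := rfl
    rw [Nat.testBit, h1]
    cases hh : (1 &&& D >>> d) <;> rfl
  unfold recordBit at h
  rw [key] at h
  by_cases hb : D.testBit d = true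
  · have hm := (hF d hd).1 hb
    rw [Finset.insert_eq_of_mem hm]
    rw [hb] at h
    cases b with
    | zero => right; omega
    | succ c => exact Or.inl ⟨D, c, h, hF, by omega⟩
  · have hm := fun hh => hb ((hF d hd).2 hh)
    simp only [Bool.not_eq_true] at hb
    rw [hb] at h
    exact Or.inl ⟨_, b, h, hF.insert hd, by rw [Finset.card_insert_of_notMem hm]⟩

/-- The residues of a list of numbers. -/
def residues (n : ℕ) (A : List ℕ) : Finset (ZMod n) := (A.map fun a => (a : ZMod n)).toFinset

theorem residues_cons (n a : ℕ) (A : List ℕ) :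
    residues n (a :: A) = insert (a : ZMod n) (residues n A) := by
  simp [residues]

theorem cast_sub_mod {n a x : ℕ} (hx : x < n) :
    ((Nat.mod (Nat.sub (Nat.add a n) x) n : ℕ) : ZMod n) = a - x := by
  change (((a + n - x) % n : ℕ) : ZMod n) = _
  rw [ZMod.natCast_mod, Nat.cast_sub (by omega)]
  simp

/-- The differences of `x` with the members of `A`, in both directions. -/
def crossDifferences {Γ : Type*} [AddGroup Γ] [DecidableEq Γ] (x : Γ) (A : Finset Γ) : Finset Γ :=
  (A.image fun a => a - x) ∪ A.image fun a => x - a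

theorem crossDifferences_insert {Γ : Type*} [AddGroup Γ] [DecidableEq Γ] (x a : Γ) (A : Finset Γ) :
    crossDifferences x (insert a A) = insert (x - a) (insert (a - x) (crossDifferences x A)) := by
  ext g
  simp only [crossDifferences, Finset.image_insert, Finset.mem_union, Finset.mem_insert]
  tauto

theorem recordDifferences_sound {n x : ℕ} (hx : x < n) {k : ℕ → ℕ → Bool} (A : List ℕ)
    (hA : ∀ a ∈ A, a < n) : ∀ (D b : ℕ) (F : Finset (ZMod n)),
    recordDifferences n x A D b k = true → Encodes D F →
    (∃ D' b', k D' b' = true ∧ Encodes D' (F ∪ crossDifferences (x : ZMod n) (residues n A)) ∧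
      (F ∪ crossDifferences (x : ZMod n) (residues n A)).card + b = F.card + 2 * A.length + b') ∨
    (F ∪ crossDifferences (x : ZMod n) (residues n A)).card + b < F.card + 2 * A.length := by
  induction A with
  | nil =>
    intro D b F h hF
    left
    refine ⟨D, b, h, ?_⟩
    simpa [crossDifferences, residues] using hF
  | cons a A ih =>
    intro D b F h hF
    have han : a < n := hA a (by simp)
    have hset : F ∪ crossDifferences (x : ZMod n) (residues n (a :: A)) =
        insert ((x : ZMod n) - a) (insert ((a : ZMod n) - x) F) ∪
          crossDifferences (x : ZMod n) (residues n A) := by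
      rw [residues_cons, crossDifferences_insert]
      simp only [Finset.insert_union, Finset.union_insert]
    -- Each difference adds at most one element, so an overdrawn budget is never recovered by the
    -- differences still to be recorded.
    have grow : ∀ G : Finset (ZMod n),
        (G ∪ crossDifferences (x : ZMod n) (residues n A)).card ≤ G.card + 2 * A.length := by
      intro G
      have h0 : (residues n A).card ≤ A.length := by
        simpa [residues] using List.toFinset_card_le (A.map fun a => (a : ZMod n))
      have h1 := Finset.card_union_le G (crossDifferences (x : ZMod n) (residues n A))
      have h2 : (crossDifferences (x : ZMod n) (residues n A)).card ≤ _ := Finset.card_union_le _ _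
      have h3 := Finset.card_image_le (s := residues n A) (f := fun a => a - (x : ZMod n))
      have h4 := Finset.card_image_le (s := residues n A) (f := fun a => (x : ZMod n) - a)
      omega
    rw [hset, List.length_cons]
    have hn : 0 < n := by omega
    have c1 := cast_sub_mod (a := a) hx
    have c2 := cast_sub_mod (a := x) han
    replace h : recordBit D b (Nat.mod (Nat.sub (Nat.add a n) x) n) (fun D b =>
      recordBit D b (Nat.mod (Nat.sub (Nat.add x n) a) n) fun D b =>
        recordDifferences n x A D b k) = true := h
    rcases recordBit_sound (d := Nat.mod (Nat.sub (Nat.add a n) x) n) h hF (Nat.mod_lt _ hn) with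
      ⟨D1, b1, h1, hF1, e1⟩ | e1
    · rw [c1] at hF1 e1
      rcases recordBit_sound (d := Nat.mod (Nat.sub (Nat.add x n) a) n) h1 hF1
        (Nat.mod_lt _ hn) with ⟨D2, b2, h2, hF2, e2⟩ | e2
      · rw [c2] at hF2 e2
        rcases ih (fun a ha => hA a (by simp [ha])) D2 b2 _ h2 hF2 with ⟨D3, b3, h3, hF3, e3⟩ | e3
        · exact Or.inl ⟨D3, b3, h3, hF3, by omega⟩
        · right; omega
      · rw [c2] at e2
        have := grow (insert ((x : ZMod n) - a) (insert ((a : ZMod n) - x) F))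
        right; omega
    · rw [c1] at e1
      have := grow (insert ((x : ZMod n) - a) (insert ((a : ZMod n) - x) F))
      have := Finset.card_insert_le ((x : ZMod n) - a) (insert ((a : ZMod n) - x) F)
      right; omega

theorem sub_insert_insert {Γ : Type*} [AddGroup Γ] [DecidableEq Γ] (x : Γ) {A : Finset Γ}
    (hA : A.Nonempty) : insert x A - insert x A = (A - A) ∪ crossDifferences x A := by
  ext g
  obtain ⟨c, hc⟩ := hA
  simp only [crossDifferences, Finset.mem_sub, Finset.mem_union, Finset.mem_image,
    Finset.mem_insert]
  constructor
  · rintro ⟨a, rfl | ha, b, rfl | hb, rfl⟩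
    · exact Or.inl ⟨c, hc, c, hc, by simp⟩
    · exact Or.inr (Or.inr ⟨b, hb, rfl⟩)
    · exact Or.inr (Or.inl ⟨a, ha, rfl⟩)
    · exact Or.inl ⟨a, ha, b, hb, rfl⟩
  · rintro (⟨a, ha, b, hb, rfl⟩ | ⟨a, ha, rfl⟩ | ⟨a, ha, rfl⟩)
    · exact ⟨a, Or.inr ha, b, Or.inr hb, rfl⟩
    · exact ⟨a, Or.inr ha, x, Or.inl rfl, rfl⟩
    · exact ⟨x, Or.inl rfl, a, Or.inr ha, rfl⟩

/-- Each ordered pair of `S` not inside `A` contributes at most one new difference: passing to a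
superset never removes repetitions. -/
theorem card_sub_self_le {Γ : Type*} [AddGroup Γ] [DecidableEq Γ] {A S : Finset Γ}
    (hA : A.Nonempty) (hAS : A ⊆ S) :
    (S - S).card + A.card * (A.card - 1) ≤ (A - A).card + S.card * (S.card - 1) := by
  have hsub : S - S ⊆ (A - A) ∪ (S.offDiag \ A.offDiag).image fun p => p.1 - p.2 := by
    intro g hg
    obtain ⟨c, hc⟩ := hA
    obtain ⟨a, ha, b, hb, rfl⟩ := Finset.mem_sub.1 hg
    rw [Finset.mem_union]
    by_cases hab : a = b
    · exact Or.inl (Finset.mem_sub.2 ⟨c, hc, c, hc, by simp [hab]⟩)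
    by_cases h : a ∈ A ∧ b ∈ A
    · exact Or.inl (Finset.sub_mem_sub h.1 h.2)
    · refine Or.inr (Finset.mem_image.2 ⟨(a, b), ?_, rfl⟩)
      simp only [Finset.mem_sdiff, Finset.mem_offDiag]
      exact ⟨⟨ha, hb, hab⟩, fun h' => h ⟨h'.1, h'.2.1⟩⟩
  have h1 := (Finset.card_le_card hsub).trans (Finset.card_union_le _ _)
  have h2 := Finset.card_image_le (s := S.offDiag \ A.offDiag) (f := fun p => p.1 - p.2)
  have h3 := Finset.card_sdiff_add_card_eq_card (Finset.offDiag_mono hAS)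
  rw [Finset.offDiag_card, Finset.offDiag_card, ← Nat.mul_sub_one, ← Nat.mul_sub_one] at h3
  omega

/-- The inequality says that enlarging `A` to `S` creates more than `b` repetitions. The induction
on `x` decides whether the largest remaining candidate joins `A`. -/
theorem noExtension_sound {n : ℕ} (x : ℕ) (hx : x ≤ n) : ∀ (r : ℕ) (A : List ℕ) (D b : ℕ),
    noExtension n x r A D b = true → A ≠ [] → (∀ a ∈ A, a < n) →
    (residues n A).card = A.length → Encodes D (residues n A - residues n A) →
    ∀ S : Finset (ZMod n), residues n A ⊆ S → S.card = A.length + r →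
      (∀ s ∈ S, s ∈ residues n A ∨ ∃ y < x, (y : ZMod n) = s) →
      (S - S).card + b + A.length * (A.length - 1) <
        (residues n A - residues n A).card + S.card * (S.card - 1) := by
  induction x with
  | zero =>
    intro r A D b h _ _ hA _ S _ hS hcov
    have hSA : S ⊆ residues n A := fun s hs => (hcov s hs).resolve_right (by simp)
    have := Finset.card_le_card hSA
    have hr : r = 0 := by omega
    subst hr
    exact absurd (show false = true from h) (by simp)
  | succ y ih =>
    intro r A D b h hne hlt hA hD S hAS hS hcov
    cases r with
    | zero => exact absurd (show false = true from h) (by simp)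
    | succ s =>
    have h : (match noExtension n y (s + 1) A D b with
        | true => recordDifferences n y A D b fun D b => noExtension n y s (y :: A) D b
        | false => false) = true := h
    cases h0 : noExtension n y (s + 1) A D b with
    | false => simp [h0] at h
    | true =>
    rw [h0] at h
    replace h : recordDifferences n y A D b (fun D b => noExtension n y s (y :: A) D b) = true := h
    by_cases hy : (y : ZMod n) ∈ S ∧ (y : ZMod n) ∉ residues n A
    · have hyn : y < n := hx
      have hneA : (residues n A).Nonempty := by
        rw [← Finset.card_pos, hA]
        exact List.length_pos_of_ne_nil hne
      have hins := sub_insert_insert (y : ZMod n) hneA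
      have hcard : (residues n (y :: A)).card = A.length + 1 := by
        rw [residues_cons, Finset.card_insert_of_notMem hy.2, hA]
      have hsub : residues n (y :: A) ⊆ S := by
        rw [residues_cons]
        exact Finset.insert_subset hy.1 hAS
      have harith : (A.length + 1) * A.length = A.length * (A.length - 1) + 2 * A.length := by
        cases A.length with
        | zero => simp
        | succ m => simp only [Nat.add_sub_cancel]; ring
      rcases recordDifferences_sound hyn A hlt D b _ h hD with ⟨D', b', h', hD', e⟩ | e
      · rw [← hins, ← residues_cons] at hD' e
        have := ih (by omega) s (y :: A) D' b' h' (by simp)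
          (by simpa using ⟨hyn, hlt⟩) (by simpa using hcard) hD' S hsub
          (by simp only [List.length_cons]; omega) (by
            intro t ht
            rcases hcov t ht with h1 | ⟨z, hz, rfl⟩
            · exact Or.inl (by rw [residues_cons]; exact Finset.mem_insert_of_mem h1)
            · rcases Nat.lt_succ_iff_lt_or_eq.1 hz with hz | rfl
              · exact Or.inr ⟨z, hz, rfl⟩
              · exact Or.inl (by rw [residues_cons]; exact Finset.mem_insert_self _ _))
        simp only [List.length_cons, Nat.add_sub_cancel, harith] at this
        omega
      · rw [← hins, ← residues_cons] at e
        have := card_sub_self_le (hneA.mono (residues_cons n y A ▸ Finset.subset_insert _ _)) hsub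
        rw [hcard, Nat.add_sub_cancel, harith] at this
        omega
    -- Either `y` is outside `S` or it adds nothing to `A`, so the branch skipping `y` applies.
    · refine ih (by omega) (s + 1) A D b h0 hne hlt hA hD S hAS hS fun t ht => ?_
      rcases hcov t ht with h1 | ⟨z, hz, rfl⟩
      · exact Or.inl h1
      · rcases Nat.lt_succ_iff_lt_or_eq.1 hz with hz | rfl
        · exact Or.inr ⟨z, hz, rfl⟩
        · exact Or.inl (by by_contra hc; exact hy ⟨ht, hc⟩)

/-- A successful search rules out covering sets that contain the starting list. -/
theorem noExtension_not_covering {n : ℕ} [NeZero n] {A : List ℕ} {D b r : ℕ}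
    (h : noExtension n n r A D b = true) (hne : A ≠ []) (hlt : ∀ a ∈ A, a < n)
    (hA : (residues n A).card = A.length)
    (hD : ∀ d < n, D.testBit d = true ↔ (d : ZMod n) ∈ residues n A - residues n A)
    (hb : (residues n A - residues n A).card + (A.length + r) * (A.length + r - 1) ≤
      n + b + A.length * (A.length - 1))
    {S : Finset (ZMod n)} (hAS : residues n A ⊆ S) (hS : S.card = A.length + r) :
    S - S ≠ Finset.univ := by
  intro hcov
  have := noExtension_sound n le_rfl r A D b h hne hlt hA hD S hAS hS fun s _ =>
    Or.inr ⟨s.val, ZMod.val_lt s, ZMod.natCast_zmod_val s⟩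
  rw [hcov, hS, Finset.card_univ, ZMod.card] at this
  omega

/-! ### Searches in the cyclic groups of order 43, 41 and 40 -/

theorem zmod43_sub_ne_univ {S : Finset (ZMod 43)} (h0 : 0 ∈ S) (h1 : 1 ∈ S) (hS : S.card = 7) :
    S - S ≠ Finset.univ :=
  noExtension_not_covering (A := [0, 1]) (D := 1 + 2 + 2 ^ 42) (b := 0) (r := 5)
    (by decide +kernel) (by decide) (by decide) (by decide) (by decide +kernel) (by decide +kernel)
    (by simp [residues, Finset.insert_subset_iff, h0, h1]) hS

theorem zmod41_sub_ne_univ {S : Finset (ZMod 41)} (h0 : 0 ∈ S) (h1 : 1 ∈ S) (h2 : 2 ∈ S)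
    (hS : S.card = 7) : S - S ≠ Finset.univ :=
  noExtension_not_covering (A := [0, 1, 2]) (D := 1 + 2 + 2 ^ 2 + 2 ^ 39 + 2 ^ 40) (b := 0) (r := 4)
    (by decide +kernel) (by decide) (by decide) (by decide) (by decide +kernel) (by decide +kernel)
    (by simp [residues, Finset.insert_subset_iff, h0, h1, h2]) hS

/-- Order 40 allows three repetitions. The progression uses two, leaving `b = 1`; for `g = 10` also
`20 = -20`, so nothing is left. -/
theorem zmod40_sub_ne_univ {S : Finset (ZMod 40)} {g : ZMod 40}
    (hg : g = 1 ∨ g = 2 ∨ g = 4 ∨ g = 5 ∨ g = 8 ∨ g = 10) (h0 : 0 ∈ S) (h1 : g ∈ S)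
    (h2 : g + g ∈ S) (hS : S.card = 7) : S - S ≠ Finset.univ := by
  rcases hg with rfl | rfl | rfl | rfl | rfl | rfl
  · replace h2 : (2 : ZMod 40) ∈ S := h2
    exact noExtension_not_covering (A := [0, 1, 2]) (D := 1 + 2 + 2 ^ 2 + 2 ^ 38 + 2 ^ 39) (b := 1)
      (r := 4) (by decide +kernel) (by decide) (by decide) (by decide) (by decide +kernel)
      (by decide +kernel) (by simp [residues, Finset.insert_subset_iff, h0, h1, h2]) hS
  · replace h2 : (4 : ZMod 40) ∈ S := h2
    exact noExtension_not_covering (A := [0, 2, 4]) (D := 1 + 2 ^ 2 + 2 ^ 4 + 2 ^ 36 + 2 ^ 38)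
      (b := 1) (r := 4) (by decide +kernel) (by decide) (by decide) (by decide) (by decide +kernel)
      (by decide +kernel) (by simp [residues, Finset.insert_subset_iff, h0, h1, h2]) hS
  · replace h2 : (8 : ZMod 40) ∈ S := h2
    exact noExtension_not_covering (A := [0, 4, 8]) (D := 1 + 2 ^ 4 + 2 ^ 8 + 2 ^ 32 + 2 ^ 36)
      (b := 1) (r := 4) (by decide +kernel) (by decide) (by decide) (by decide) (by decide +kernel)
      (by decide +kernel) (by simp [residues, Finset.insert_subset_iff, h0, h1, h2]) hS
  · replace h2 : (10 : ZMod 40) ∈ S := h2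
    exact noExtension_not_covering (A := [0, 5, 10]) (D := 1 + 2 ^ 5 + 2 ^ 10 + 2 ^ 30 + 2 ^ 35)
      (b := 1) (r := 4) (by decide +kernel) (by decide) (by decide) (by decide) (by decide +kernel)
      (by decide +kernel) (by simp [residues, Finset.insert_subset_iff, h0, h1, h2]) hS
  · replace h2 : (16 : ZMod 40) ∈ S := h2
    exact noExtension_not_covering (A := [0, 8, 16]) (D := 1 + 2 ^ 8 + 2 ^ 16 + 2 ^ 24 + 2 ^ 32)
      (b := 1) (r := 4) (by decide +kernel) (by decide) (by decide) (by decide) (by decide +kernel)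
      (by decide +kernel) (by simp [residues, Finset.insert_subset_iff, h0, h1, h2]) hS
  · replace h2 : (20 : ZMod 40) ∈ S := h2
    exact noExtension_not_covering (A := [0, 10, 20]) (D := 1 + 2 ^ 10 + 2 ^ 20 + 2 ^ 30) (b := 0)
      (r := 4) (by decide +kernel) (by decide) (by decide) (by decide) (by decide +kernel)
      (by decide +kernel) (by simp [residues, Finset.insert_subset_iff, h0, h1, h2]) hS

/-- Affine images of covering sets of `ZMod n` are covering sets. -/
theorem affine_image_covering {n : ℕ} [NeZero n] {S : Finset (ZMod n)} (hS : S - S = Finset.univ)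
    (a : ZMod n) {v w : ZMod n} (hvw : v * w = 1) :
    (S.image fun s => v * (s - a)) - (S.image fun s => v * (s - a)) = Finset.univ ∧
      (S.image fun s => v * (s - a)).card = S.card := by
  constructor
  · rw [Finset.eq_univ_iff_forall]
    intro g
    obtain ⟨b, hb, c, hc, h⟩ := Finset.mem_sub.1 (hS ▸ Finset.mem_univ (w * g))
    refine Finset.mem_sub.2 ⟨_, Finset.mem_image_of_mem _ hb, _, Finset.mem_image_of_mem _ hc, ?_⟩
    linear_combination v * h + g * hvw
  · refine Finset.card_image_of_injective _ fun b c h => ?_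
    have h : v * (b - a) = v * (c - a) := h
    linear_combination w * h - (b - c) * hvw

/-! ### Coinciding differences and three-term progressions -/

theorem offDiag_card_seven {α : Type*} [DecidableEq α] {S : Finset α} (hS : S.card = 7) :
    S.offDiag.card = 42 := by
  rw [Finset.offDiag_card, hS]

section Collision

variable {Γ : Type*} [AddCommGroup Γ] [Fintype Γ] [DecidableEq Γ] {S : Finset Γ}

theorem exists_offDiag_sub_eq (hcov : S - S = Finset.univ) {g : Γ} (hg : g ≠ 0) :
    ∃ p ∈ S.offDiag, p.1 - p.2 = g := by
  obtain ⟨a, ha, b, hb, h⟩ := Finset.mem_sub.1 (hcov ▸ Finset.mem_univ g)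
  refine ⟨(a, b), Finset.mem_offDiag.2 ⟨ha, hb, ?_⟩, h⟩
  intro hab
  replace hab : a = b := hab
  exact hg (by simpa [hab] using h.symm)

/-- Otherwise the four elements form a parallelogram: `a - b = c - d` and `a - c = b - d`, with
their negatives. Four pairs are then redundant, and 38 pairs cannot give 39 nonzero differences. -/
theorem eq_or_eq_of_sub_eq_sub (hS : S.card = 7) (hcov : S - S = Finset.univ)
    (hΓ : 40 ≤ Fintype.card Γ) {a b c d : Γ} (hab : (a, b) ∈ S.offDiag) (hcd : (c, d) ∈ S.offDiag)
    (hne : (a, b) ≠ (c, d)) (h : a - b = c - d) : a = d ∨ b = c := by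
  by_contra! hcon
  obtain ⟨had, hbc⟩ := hcon
  obtain ⟨ha, hb, hab⟩ := Finset.mem_offDiag.1 hab
  obtain ⟨hc, hd, hcd⟩ := Finset.mem_offDiag.1 hcd
  simp only at ha hb hab hc hd hcd
  have hac : a ≠ c := by
    rintro rfl
    exact hne (by rw [sub_right_injective h])
  have hbd : b ≠ d := by
    rintro rfl
    exact hac (sub_left_injective h)
  set R : Finset (Γ × Γ) := {(a, b), (b, a), (a, c), (c, a)} with hR
  have hRc : R.card = 4 := by
    rw [hR, Finset.card_insert_of_notMem, Finset.card_insert_of_notMem,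
      Finset.card_insert_of_notMem, Finset.card_singleton] <;>
    simp [hab, hac, hbc, hab.symm, hac.symm]
  have hRS : R ⊆ S.offDiag := by
    simp [hR, Finset.insert_subset_iff, Finset.mem_offDiag, ha, hb, hc, hab, hac, hab.symm,
      hac.symm]
  have hsub : Finset.univ.erase (0 : Γ) ⊆ (S.offDiag \ R).image fun p => p.1 - p.2 := by
    intro g hg
    obtain ⟨p, hp, rfl⟩ := exists_offDiag_sub_eq hcov (Finset.ne_of_mem_erase hg)
    by_cases hpR : p ∈ R
    · have key : ∀ x y : Γ, x ∈ S → y ∈ S → x ≠ y → (x, y) ∉ R → x - y = p.1 - p.2 →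
          p.1 - p.2 ∈ (S.offDiag \ R).image fun p => p.1 - p.2 := fun x y hx hy hxy hn he =>
        Finset.mem_image.2 ⟨(x, y), Finset.mem_sdiff.2 ⟨Finset.mem_offDiag.2 ⟨hx, hy, hxy⟩, hn⟩, he⟩
      simp only [hR, Finset.mem_insert, Finset.mem_singleton] at hpR
      have h' : a - c = b - d := by rw [sub_eq_sub_iff_add_eq_add] at h ⊢; rw [h, add_comm]
      rcases hpR with rfl | rfl | rfl | rfl
      · exact key c d hc hd hcd (by simp [hR, hac.symm, hbc.symm, had.symm]) h.symm
      · exact key d c hd hc hcd.symm (by simp [hR, hac.symm, hbc.symm, had.symm, hcd.symm])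
          (by rw [← neg_sub c d, ← h, neg_sub])
      · exact key b d hb hd hbd (by simp [hR, hab.symm, hbc, had.symm]) h'.symm
      · exact key d b hd hb hbd.symm (by simp [hR, hab.symm, hbc, had.symm, hbd.symm])
          (by rw [← neg_sub b d, ← h', neg_sub])
    · exact Finset.mem_image_of_mem _ (Finset.mem_sdiff.2 ⟨hp, hpR⟩)
  have h1 := (Finset.card_le_card hsub).trans Finset.card_image_le
  rw [Finset.card_erase_of_mem (Finset.mem_univ _), Finset.card_univ,
    Finset.card_sdiff_of_subset hRS, hRc, offDiag_card_seven hS] at h1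
  omega

/-- Without a progression, an element is a difference at most once, or twice if it is an involution
(as `a - b` and `b - a`). `hsum` says that this cannot account for all 42 pairs. -/
theorem exists_arithmetic_progression (hS : S.card = 7) (hcov : S - S = Finset.univ)
    (hΓ : 40 ≤ Fintype.card Γ)
    (hsum : ∑ g ∈ Finset.univ.erase (0 : Γ), (if g + g = 0 then 2 else 1) < 42) :
    ∃ a g : Γ, g + g ≠ 0 ∧ a ∈ S ∧ a + g ∈ S ∧ a + g + g ∈ S := by
  by_contra! hcon
  have hmaps : ∀ p ∈ S.offDiag, p.1 - p.2 ∈ Finset.univ.erase (0 : Γ) := fun p hp =>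
    Finset.mem_erase.2 ⟨sub_ne_zero.2 (Finset.mem_offDiag.1 hp).2.2, Finset.mem_univ _⟩
  have hcount := Finset.card_eq_sum_card_fiberwise hmaps
  rw [offDiag_card_seven hS] at hcount
  refine absurd hcount.le (not_le.2 (lt_of_le_of_lt (Finset.sum_le_sum fun g _ => ?_) hsum))
  split_ifs with hg
  · rcases (S.offDiag.filter fun p => p.1 - p.2 = g).eq_empty_or_nonempty with he | ⟨⟨a, b⟩, hp⟩
    · simp [he]
    · refine (Finset.card_le_card (t := {(a, b), (b, a)}) ?_).trans Finset.card_le_two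
      rintro ⟨c, d⟩ hq
      rw [Finset.mem_filter] at hp hq
      by_cases hne : (a, b) = (c, d)
      · simp [hne]
      have e1 : a = g + b := sub_eq_iff_eq_add.1 hp.2
      have e2 : c = g + d := sub_eq_iff_eq_add.1 hq.2
      rcases eq_or_eq_of_sub_eq_sub hS hcov hΓ hp.1 hq.1 hne (hp.2.trans hq.2.symm) with rfl | rfl
      · have : c = b := by rw [e2, e1, ← add_assoc, hg, zero_add]
        simp [this]
      · have : d = a := by rw [e1, e2, ← add_assoc, hg, zero_add]
        simp [this]
  · rw [Finset.card_le_one]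
    rintro ⟨a, b⟩ hp ⟨c, d⟩ hq
    rw [Finset.mem_filter] at hp hq
    by_contra hne
    have e1 : a = b + g := by rw [add_comm]; exact sub_eq_iff_eq_add.1 hp.2
    have e2 : c = d + g := by rw [add_comm]; exact sub_eq_iff_eq_add.1 hq.2
    obtain ⟨ha, hb, -⟩ := Finset.mem_offDiag.1 hp.1
    obtain ⟨hc, hd, -⟩ := Finset.mem_offDiag.1 hq.1
    rcases eq_or_eq_of_sub_eq_sub hS hcov hΓ hp.1 hq.1 hne (hp.2.trans hq.2.symm) with rfl | rfl
    · exact hcon b g hg hb (e1 ▸ ha) (e1 ▸ e2 ▸ hc)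
    · exact hcon d g hg hd (e2 ▸ hc) (e2 ▸ e1 ▸ ha)

end Collision

/-! ### Cyclic groups: reduction to the searches -/

theorem zmod43_not_covering {S : Finset (ZMod 43)} (hS : S.card = 7) : S - S ≠ Finset.univ := by
  intro hcov
  obtain ⟨a, ha, b, hb, h⟩ := Finset.mem_sub.1 (hcov ▸ Finset.mem_univ (1 : ZMod 43))
  obtain ⟨h1, h2⟩ := affine_image_covering hcov b (one_mul 1)
  exact zmod43_sub_ne_univ (Finset.mem_image.2 ⟨b, hb, by ring⟩)
    (Finset.mem_image.2 ⟨a, ha, by rw [h, one_mul]⟩) (h2.trans hS) h1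

theorem zmod41_not_covering {S : Finset (ZMod 41)} (hS : S.card = 7) : S - S ≠ Finset.univ := by
  intro hcov
  obtain ⟨a, g, hg, h0, h1, h2⟩ := exists_arithmetic_progression hS hcov (by simp)
    (by decide +kernel)
  obtain ⟨v, hv⟩ : ∃ v : ZMod 41, v * g = 1 := by
    have key : ∀ g : ZMod 41, g + g ≠ 0 → ∃ v : ZMod 41, v * g = 1 := by decide +kernel
    exact key g hg
  obtain ⟨k1, k2⟩ := affine_image_covering hcov a hv
  refine zmod41_sub_ne_univ (Finset.mem_image.2 ⟨a, h0, by ring⟩)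
    (Finset.mem_image.2 ⟨_, h1, ?_⟩) (Finset.mem_image.2 ⟨_, h2, ?_⟩) (k2.trans hS) k1
  · linear_combination hv
  · linear_combination 2 * hv

theorem zmod40_not_covering {S : Finset (ZMod 40)} (hS : S.card = 7) : S - S ≠ Finset.univ := by
  intro hcov
  obtain ⟨a, g, hg, h0, h1, h2⟩ := exists_arithmetic_progression hS hcov (by simp)
    (by decide +kernel)
  -- Units modulo 40 satisfy `v ^ 4 = 1`, and every residue is a unit times a divisor of 40; the
  -- condition excludes 0 and 20.
  have key : ∀ g : ZMod 40, g + g ≠ 0 → ∃ v : ZMod 40, v * v ^ 3 = 1 ∧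
      (v * g = 1 ∨ v * g = 2 ∨ v * g = 4 ∨ v * g = 5 ∨ v * g = 8 ∨ v * g = 10) := by
    decide +kernel
  obtain ⟨v, hv, hvg⟩ := key g hg
  obtain ⟨k1, k2⟩ := affine_image_covering hcov a hv
  refine zmod40_sub_ne_univ hvg (Finset.mem_image.2 ⟨a, h0, by ring⟩)
    (Finset.mem_image.2 ⟨_, h1, ?_⟩) (Finset.mem_image.2 ⟨_, h2, ?_⟩) (k2.trans hS) k1 <;>
  ring

/-! ### Orders 40 and 42: summands of order 2 -/

theorem isAddCyclic_or_exists_hom_zmod_two {Γ : Type*} [AddCommGroup Γ] [Finite Γ]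
    (h : Nat.card Γ = 40 ∨ Nat.card Γ = 42) :
    (IsAddCyclic Γ ∧ Nat.card Γ = 40) ∨ ∃ (χ : Γ →+ ZMod 2) (t : Γ), t + t = 0 ∧ χ t = 1 := by
  classical
  obtain ⟨ι, hι, n, hn, ⟨e⟩⟩ := AddCommGroup.equiv_directSum_zmod_of_finite' Γ
  let f : Γ ≃+ (∀ i, ZMod (n i)) := e.trans (DirectSum.addEquivProd _)
  have hprod : Nat.card Γ = ∏ i, n i := by
    rw [Nat.card_congr f.toEquiv, Nat.card_pi]
    simp
  have hval : padicValNat 2 (∏ i, n i) = ∑ i, padicValNat 2 (n i) := by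
    simp only [← Nat.factorization_def _ Nat.prime_two]
    rw [Nat.factorization_prod fun i _ => by have := hn i; omega]
    simp
  have hfac : ∀ i, n i ∣ Nat.card Γ := fun i => hprod ▸ Finset.dvd_prod_of_mem n (Finset.mem_univ i)
  have v42 : padicValNat 2 42 = 1 := by
    rw [show 42 = 2 * 21 from rfl, padicValNat.mul (by norm_num) (by norm_num),
      padicValNat.self (by norm_num), padicValNat.eq_zero_of_not_dvd (by norm_num)]
  have v40 : padicValNat 2 40 = 3 := by
    rw [show 40 = 2 ^ 3 * 5 from rfl, padicValNat.mul (by norm_num) (by norm_num),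
      padicValNat.prime_pow, padicValNat.eq_zero_of_not_dvd (by norm_num)]
  -- The 2-adic valuation of the order is 3 or 1, hence odd, so some cyclic factor has odd
  -- valuation. Valuation 1 splits off a summand of order 2; otherwise 8 divides the exponent, and
  -- so does 5.
  obtain ⟨i, hi⟩ : ∃ i, Odd (padicValNat 2 (n i)) := by
    by_contra! hcon
    have : Even (∑ i, padicValNat 2 (n i)) :=
      Finset.even_sum _ fun i _ => Nat.not_odd_iff_even.1 (hcon i)
    rw [← hval, ← hprod] at this
    rcases h with h | h
    · rw [h, v40] at this; exact absurd this (by decide)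
    · rw [h, v42] at this; exact absurd this (by decide)
  have hpos : n i ≠ 0 := by have := hn i; omega
  have h2 : 2 ∣ n i := dvd_of_one_le_padicValNat hi.pos
  by_cases h4 : 4 ∣ n i
  · left
    have h40 : Nat.card Γ = 40 := by
      refine h.resolve_right fun h => ?_
      have := h4.trans (hfac i)
      rw [h] at this
      exact absurd this (by norm_num)
    refine ⟨?_, h40⟩
    have h8 : 8 ∣ n i := by
      have h1 : 2 ≤ padicValNat 2 (n i) :=
        (padicValNat_dvd_iff_le hpos).1 h4
      have : 3 ≤ padicValNat 2 (n i) := by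
        rcases hi with ⟨k, hk⟩
        omega
      exact (padicValNat_dvd_iff_le (n := 3) hpos).2 this
    have ho : n i ∣ addOrderOf (f.symm (Pi.single i 1)) := by
      have h0 := congrArg (fun y => f y i) (addOrderOf_nsmul_eq_zero (f.symm (Pi.single i 1)))
      rw [← ZMod.natCast_eq_zero_iff]
      simpa using h0
    have e8 : 8 ∣ AddMonoid.exponent Γ :=
      (h8.trans ho).trans (AddMonoid.addOrder_dvd_exponent _)
    have e5 : 5 ∣ AddMonoid.exponent Γ := by
      have : Fact (Nat.Prime 5) := ⟨by norm_num⟩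
      obtain ⟨x, hx⟩ := exists_prime_addOrderOf_dvd_card' (G := Γ) 5 (by rw [h40]; norm_num)
      exact hx ▸ AddMonoid.addOrder_dvd_exponent x
    have e40 : 40 ∣ AddMonoid.exponent Γ := Nat.Coprime.mul_dvd_of_dvd_of_dvd (by norm_num) e8 e5
    refine IsAddCyclic.of_exponent_eq_card (Nat.dvd_antisymm ?_ (h40 ▸ e40))
    exact AddGroup.exponent_dvd_nat_card
  · right
    obtain ⟨m, hm⟩ := h2
    refine ⟨((ZMod.castHom (show 2 ∣ n i from ⟨m, hm⟩) (ZMod 2)).toAddMonoidHom.comp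
      (Pi.evalAddMonoidHom _ i)).comp f.toAddMonoidHom, f.symm (Pi.single i (m : ZMod (n i))), ?_, ?_⟩
    · rw [← map_add, ← Pi.single_add, ← Nat.cast_add, ← two_mul, ← hm]
      simp
    · have : Odd m := by
        rw [← Nat.not_even_iff_odd]
        rintro ⟨k, hk⟩
        exact h4 ⟨k, by omega⟩
      simpa using (ZMod.natCast_eq_one_iff_odd).2 this

/-- With `x` elements of `S` in the kernel, `2x(7 - x)` pairs have difference outside it. The
involution `t` lies there and arises from both `(a, b)` and `(b, a)`, so one of these pairs is
wasted. -/
theorem sub_ne_univ_of_hom_zmod_two {Γ : Type*} [AddCommGroup Γ] [Fintype Γ] [DecidableEq Γ]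
    (h : Fintype.card Γ = 40 ∨ Fintype.card Γ = 42) {S : Finset Γ} (hS : S.card = 7)
    (χ : Γ →+ ZMod 2) {t : Γ} (ht : t + t = 0) (hχ : χ t = 1) : S - S ≠ Finset.univ := by
  intro hcov
  have two : ∀ a b : ZMod 2, a ≠ 0 → (b ≠ 0 ↔ b + a = 0) := by decide
  set P := S.offDiag.filter fun p => χ (p.1 - p.2) ≠ 0 with hP
  have hP2 : P = (S.filter fun s => χ s = 0) ×ˢ (S.filter fun s => ¬ χ s = 0) ∪
      (S.filter fun s => ¬ χ s = 0) ×ˢ (S.filter fun s => χ s = 0) := by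
    ext ⟨a, b⟩
    have key : ∀ x y : ZMod 2, x - y ≠ 0 ↔ (x = 0 ∧ ¬ y = 0) ∨ (¬ x = 0 ∧ y = 0) := by decide
    have hab : χ a - χ b ≠ 0 → a ≠ b := by rintro h rfl; simp at h
    simp only [hP, Finset.mem_filter, Finset.mem_offDiag, Finset.mem_union, Finset.mem_product,
      map_sub]
    have := key (χ a) (χ b)
    tauto
  have hPc : P.card =
      2 * ((S.filter fun s => χ s = 0).card * (S.filter fun s => ¬ χ s = 0).card) := by
    rw [hP2, Finset.card_union_of_disjoint, Finset.card_product, Finset.card_product]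
    · ring
    · rw [Finset.disjoint_left]
      rintro ⟨a, b⟩ h1 h2
      simp only [Finset.mem_filter, Finset.mem_product] at h1 h2
      exact h2.1.2 h1.1.2
  have hoe := Finset.card_filter_add_card_filter_not (s := S) (fun s => χ s = 0)
  have hPo := Finset.card_filter_add_card_filter_not (s := S.offDiag) (fun p => χ (p.1 - p.2) ≠ 0)
  have hH := Finset.card_filter_add_card_filter_not (s := (Finset.univ : Finset Γ)) (fun g => χ g ≠ 0)
  have hH2 : (Finset.univ.filter fun g => χ g ≠ 0).card =
      (Finset.univ.filter fun g => ¬ χ g ≠ 0).card := by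
    refine Finset.card_bijective (· + t) (AddGroup.addRight_bijective t) fun g => ?_
    simp [hχ, two (1 : ZMod 2) (χ g) one_ne_zero]
  have heven : ((Finset.univ.filter fun g => ¬ χ g ≠ 0).erase 0).card ≤
      (S.offDiag.filter fun p => ¬ χ (p.1 - p.2) ≠ 0).card := by
    refine (Finset.card_le_card fun g hg => ?_).trans
      (Finset.card_image_le (f := fun p : Γ × Γ => p.1 - p.2))
    rw [Finset.mem_erase, Finset.mem_filter] at hg
    obtain ⟨p, hp, rfl⟩ := exists_offDiag_sub_eq hcov hg.1
    exact Finset.mem_image_of_mem _ (Finset.mem_filter.2 ⟨hp, hg.2.2⟩)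
  have ht0 : t ≠ 0 := by rintro rfl; simp at hχ
  obtain ⟨⟨a, b⟩, hab, habt⟩ := exists_offDiag_sub_eq hcov ht0
  replace habt : a - b = t := habt
  have hba : b - a = t := by rw [← neg_sub, habt]; exact neg_eq_of_add_eq_zero_left ht
  obtain ⟨ha, hb, hne⟩ := Finset.mem_offDiag.1 hab
  have hbaP : (b, a) ∈ P :=
    Finset.mem_filter.2 ⟨Finset.mem_offDiag.2 ⟨hb, ha, Ne.symm hne⟩, by simp only [hba, hχ]; decide⟩
  have habP : (a, b) ∈ P :=
    Finset.mem_filter.2 ⟨hab, by simp only [habt, hχ]; decide⟩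
  have hodd : (Finset.univ.filter fun g => χ g ≠ 0).card ≤ (P.erase (b, a)).card := by
    refine (Finset.card_le_card fun g hg => ?_).trans
      (Finset.card_image_le (f := fun p : Γ × Γ => p.1 - p.2))
    rw [Finset.mem_filter] at hg
    obtain ⟨p, hp, rfl⟩ := exists_offDiag_sub_eq hcov (g := g) (by rintro rfl; simp at hg)
    by_cases hpe : p = (b, a)
    · refine Finset.mem_image.2 ⟨(a, b), Finset.mem_erase.2 ⟨fun h => hne ?_, habP⟩, ?_⟩
      · exact congrArg Prod.fst h
      · simp [hpe, habt, hba]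
    · exact Finset.mem_image_of_mem _
        (Finset.mem_erase.2 ⟨hpe, Finset.mem_filter.2 ⟨hp, hg.2⟩⟩)
  rw [Finset.card_erase_of_mem hbaP] at hodd
  rw [Finset.card_erase_of_mem (by simp)] at heven
  rw [offDiag_card_seven hS] at hPo
  rw [Finset.card_univ] at hH
  rw [hS] at hoe
  have hle : (S.filter fun s => χ s = 0).card ≤ 7 := by omega
  change P.card + _ = 42 at hPo
  generalize (S.filter fun s => χ s = 0).card = x at *
  have hx : (S.filter fun s => ¬ χ s = 0).card = 7 - x := by omega
  rw [hx] at hPc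
  -- The product `2x(7 - x)` is 0, 12, 20 or 24. Covering the outside needs at least 21, so 24; the
  -- 18 pairs left cannot give the 19 or 20 nonzero kernel elements.
  interval_cases x <;> omega

/-! ### Transfer between groups and the final bound -/

theorem covering_iff {Γ : Type*} [AddGroup Γ] [Fintype Γ] [DecidableEq Γ] {S : Finset Γ} :
    IsCoveringSet S ↔ S - S = Finset.univ := by
  simp only [IsCoveringSet, differenceMultiset, Multiset.mem_map, Finset.mem_val,
    Finset.mem_product, Prod.exists, Finset.eq_univ_iff_forall, Finset.mem_sub]
  exact forall_congr' fun g => ⟨fun ⟨a, b, h, e⟩ => ⟨a, h.1, b, h.2, e⟩,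
    fun ⟨a, ha, b, hb, e⟩ => ⟨a, b, ⟨ha, hb⟩, e⟩⟩

theorem IsCoveringSet.map {Γ Δ : Type*} [AddGroup Γ] [AddGroup Δ] {S : Finset Γ}
    (hS : IsCoveringSet S) (e : Γ ≃+ Δ) : IsCoveringSet (S.map e.toEquiv.toEmbedding) := by
  intro g
  have := hS (e.symm g)
  simp only [differenceMultiset, Multiset.mem_map, Finset.mem_val, Finset.mem_product,
    Prod.exists] at this ⊢
  obtain ⟨a, b, h, hg⟩ := this
  refine ⟨e a, e b, by simpa using h, ?_⟩
  rw [← map_sub, hg, e.apply_symm_apply]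

/-- Covering sets of a cyclic group of order `n` transfer to `ZMod n`. -/
theorem exists_zmod_covering {Γ : Type*} [AddGroup Γ] [IsAddCyclic Γ] {n k : ℕ} [NeZero n]
    (hn : Nat.card Γ = n) {S : Finset Γ} (hS : S.card = k) (hcov : IsCoveringSet S) :
    ∃ T : Finset (ZMod n), T.card = k ∧ T - T = Finset.univ := by
  subst hn
  let e := (zmodAddCyclicAddEquiv (G := Γ) inferInstance).symm
  exact ⟨S.map e.toEquiv.toEmbedding, by simpa using hS, covering_iff.1 (hcov.map e)⟩

theorem card_le_of_covering {Γ : Type*} [AddCommGroup Γ] [Finite Γ] {S : Finset Γ}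
    (hS : S.card = 7) (hcov : IsCoveringSet S) : Nat.card Γ ≤ 39 := by
  classical
  have := Fintype.ofFinite Γ
  have hcov' := covering_iff.1 hcov
  have hle : Fintype.card Γ ≤ 43 := by
    obtain ⟨a, ha⟩ : S.Nonempty := by rw [← Finset.card_pos, hS]; norm_num
    -- A one-element subset has one difference and no pairs, so the bound reads `1 + 42`.
    have := card_sub_self_le (Finset.singleton_nonempty a) (Finset.singleton_subset_iff.2 ha)
    rw [hcov', hS, Finset.card_univ] at this
    simpa using this
  rw [← Nat.card_eq_fintype_card] at hle
  by_contra! hlt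
  have even_case : Nat.card Γ = 40 ∨ Nat.card Γ = 42 → False := by
    intro h
    rcases isAddCyclic_or_exists_hom_zmod_two h with ⟨hc, h40⟩ | ⟨χ, t, ht, hχ⟩
    · obtain ⟨T, hT, hT'⟩ := exists_zmod_covering h40 hS hcov
      exact zmod40_not_covering hT hT'
    · exact sub_ne_univ_of_hom_zmod_two (by rwa [← Nat.card_eq_fintype_card]) hS χ ht hχ hcov'
  obtain h | h | h | h : Nat.card Γ = 40 ∨ Nat.card Γ = 41 ∨ Nat.card Γ = 42 ∨ Nat.card Γ = 43 := by
    omega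
  · exact even_case (Or.inl h)
  · have : Fact (Nat.Prime 41) := ⟨by norm_num⟩
    have := isAddCyclic_of_prime_card h
    obtain ⟨T, hT, hT'⟩ := exists_zmod_covering h hS hcov
    exact zmod41_not_covering hT hT'
  · exact even_case (Or.inr h)
  · have : Fact (Nat.Prime 43) := ⟨by norm_num⟩
    have := isAddCyclic_of_prime_card h
    obtain ⟨T, hT, hT'⟩ := exists_zmod_covering h hS hcov
    exact zmod43_not_covering hT hT'

theorem zmod39_covering : IsCoveringSet ({0, 1, 2, 4, 13, 18, 33} : Finset (ZMod 39)) :=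
  covering_iff.2 (by decide +kernel)

theorem mainTheorem7 :
    IsGreatest
      {n : ℕ | ∃ (Γ : Type u) (_ : AddCommGroup Γ), Finite Γ ∧ Nat.card Γ = n ∧
        ∃ S : Finset Γ, S.card = 7 ∧ IsCoveringSet S} 39 ∧
    IsCoveringSet ({0, 1, 2, 4, 13, 18, 33} : Finset (ZMod 39)) ∧
    IsAlmostDifferenceSet ({0, 1, 2, 4, 13, 18, 33} : Finset (ZMod 39)) 39 7 1 34 := by
  refine ⟨⟨?_, ?_⟩, zmod39_covering, ?_⟩
  · refine ⟨ULift.{u} (ZMod 39), inferInstance, inferInstance, by simp, _, ?_,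
      zmod39_covering.map AddEquiv.ulift.symm⟩
    rw [Finset.card_map]
    rfl
  · rintro n ⟨Γ, _, _, rfl, S, hS, hcov⟩
    exact card_le_of_covering hS hcov
  · refine ⟨inferInstance, by simp, rfl, ?_, by decide +kernel⟩
    rw [show {g : ZMod 39 | g ≠ 0 ∧
        (differenceMultiset ({0, 1, 2, 4, 13, 18, 33} : Finset (ZMod 39))).count g = 1} =
      ((Finset.univ.filter fun g : ZMod 39 => g ≠ 0 ∧
        (differenceMultiset ({0, 1, 2, 4, 13, 18, 33} : Finset (ZMod 39))).count g = 1 :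
          Finset (ZMod 39)) : Set (ZMod 39)) by ext; simp, Set.ncard_coe_finset]
    decide +kernel
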